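/- Let $S$ be a semitopological semigroup (a semigroup with a Hausdorff topology in which multiplication is separately continuous) that is right reversible, i.e. $\overline{Sa}\cap\overline{Sb}\neq\emptyset$ for all $a,b\in S$. Preorder $S$ by $a\le b$ iff $\overline{Sb}\cup\{b\}\subseteq\overline{Sa}\cup\{a\}$; $\lim_t$ denotes the limit as $t\in S$ increases in this order. For bounded continuous $f:S\to\mathbb C$ put $(\ell_sf)(t)=f(st)$, $(r_sf)(t)=f(ts)$. Let $C_b(S)$ be the Banach space of bounded continuous complex functions on $S$ with the supremum norm, and let $LUC(S)$, $AP(S)$, $WAP(S)$ be the subspaces of those $f\in C_b(S)$ for which, respectively, $s\mapsto \ell_sf$ is norm continuous, $\{\ell_sf:s\in S\}$ is relatively norm compact, $\{\ell_sf:s\in S\}$ is relatively weakly compact in $C_b(S)$. A mean on such a space $X$ is $m\in X^*$ with $\|m\|=m(1)=1$. Let $H$ be a complex Hilbert space, $C\subseteq H$ nonempty and closed, and $\mathcal S=\{T_s:s\in S\}$ a representation of $S$ on $C$ (maps $T_s:C\to C$ with $T_{st}=T_sT_t$) such that each $T_s$ is nonexpansive and $(s,x)\mapsto T_sx$ is separately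 continuous. Suppose that $\{T_sc:s\in S\}$ is bounded for some $c\in C$, and that one of the following holds, where $(C,\mathrm{wk})$ is $C$ with the weak topology of $H$: 1. $X=C_b(S)$ and $s\mapsto T_sc$ is continuous from $S$ into $(C,\mathrm{wk})$; 2. $X=LUC(S)$ and $(s,x)\mapsto T_sx$ is jointly continuous from $S\times(C,\mathrm{wk})$ to $(C,\mathrm{wk})$; 3. $X=AP(S)$ and $\{T_s\}$ is equicontinuous on $(C,\mathrm{wk})$; 4. $X=WAP(S)$ and every map in the closure of $\{T_s:s\in S\}$ in the product space $(C,\mathrm{wk})^{(C,\mathrm{wk})}$ is continuous; 5. $X=AP(S)$, $S$ is left reversible ($\overline{aS}\cap\overline{bS}\ne\emptyset$ for all $a,b\in S$) and separable, and $\{T_s\}$ is equicontinuous on $(C,\mathrm{wk})$. In cases 2–5 assume also that every orbit $\{T_sx:s\in S\}$ ($x\in C$) has its weak closure in $H$ contained in $C$ (this is automatic if $C$ is weakly closed). Let $(\mu_\alpha)$ be a net of means on $X$ such that, for all $s\in S$ and $f\in X$, $\mu_\alpha(f)-\mu_\alpha(\ell_sf)\to0$ and $\mu_\alpha(f)-\mu_\alpha(r_sf)\to0$.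 Then the set $A_C(\mathcal S)=\{a\in H:\|a-T_sx\|\le\|a-x\|\ \text{for all } s\in S,\ x\in C\}$ is nonempty, closed and convex; let $P_{A_C(\mathcal S)}$ be the metric projection onto it. For each $x\in C$ and each mean $m$ on $X$, the function $f_x(s)=f(T_sx)$ belongs to $X$ for every $f\in H^*$, and there is a (unique) point $T_mx\in H$ with $f(T_mx)=m(f_x)$ for all $f\in H^*$. Moreover, for each $x\in C$ the limit $$u_x=\lim_t P_{A_C(\mathcal S)}(T_tx)$$ exists in norm and lies in $A_C(\mathcal S)$, and $T_{\mu_\alpha}x\to u_x$ weakly. If in addition $\mu_\alpha\to\mu$ in the norm of $X^*$ for some $\mu\in X^*$, then $T_{\mu_\alpha}x\to u_x$ in norm. -/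

import Mathlib

open Topology Filter Set
open scoped BoundedContinuousFunction

noncomputable section

namespace Ergodic

/-! ### Function spaces on a semitopological semigroup

`S →ᵇ ℂ` is the Banach space `C_b(S)` of bounded continuous functions with the supremum norm. -/

section FunctionSpaces

variable {S : Type*} [Semigroup S] [TopologicalSpace S] [SeparatelyContinuousMul S]

/-- The left translate `(ℓ_s f)(t) = f (s t)`. -/
def leftTranslate (s : S) (f : S →ᵇ ℂ) : S →ᵇ ℂ :=
  f.compContinuous ⟨fun t => s * t, continuous_const_mul s⟩

/-- The right translate `(r_s f)(t) = f (t s)`. -/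
def rightTranslate (s : S) (f : S →ᵇ ℂ) : S →ᵇ ℂ :=
  f.compContinuous ⟨fun t => t * s, continuous_mul_const s⟩

@[simp] theorem leftTranslate_apply (s t : S) (f : S →ᵇ ℂ) :
    leftTranslate s f t = f (s * t) := rfl

@[simp] theorem rightTranslate_apply (s t : S) (f : S →ᵇ ℂ) :
    rightTranslate s f t = f (t * s) := rfl

theorem leftTranslate_add (s : S) (f g : S →ᵇ ℂ) :
    leftTranslate s (f + g) = leftTranslate s f + leftTranslate s g := rfl

theorem leftTranslate_smul (s : S) (a : ℂ) (f : S →ᵇ ℂ) :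
    leftTranslate s (a • f) = a • leftTranslate s f := rfl

theorem leftTranslate_leftTranslate (s t : S) (f : S →ᵇ ℂ) :
    leftTranslate s (leftTranslate t f) = leftTranslate (t * s) f := by
  ext u; simp [mul_assoc]

theorem leftTranslate_rightTranslate (s t : S) (f : S →ᵇ ℂ) :
    leftTranslate s (rightTranslate t f) = rightTranslate t (leftTranslate s f) := by
  ext u; simp [mul_assoc]

theorem leftTranslate_const (s : S) (a : ℂ) :
    leftTranslate s (BoundedContinuousFunction.const S a) =
      BoundedContinuousFunction.const S a := rfl

/-- Right translation as a bounded linear operator on `C_b(S)`. -/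
def rightTranslateCLM (s : S) : (S →ᵇ ℂ) →L[ℂ] (S →ᵇ ℂ) :=
  LinearMap.mkContinuous
    { toFun := rightTranslate s
      map_add' := fun _ _ => rfl
      map_smul' := fun _ _ => rfl } 1 (by
    intro f
    rw [one_mul]
    exact (BoundedContinuousFunction.norm_le (norm_nonneg f)).2 fun t => f.norm_coe_le_norm _)

/-- Linear subspaces of `C_b(S)` that contain the constants and are invariant under left and
right translations. -/
structure InvSubspace (S : Type*) [Semigroup S] [TopologicalSpace S]
    [SeparatelyContinuousMul S] where
  carrier : Submodule ℂ (S →ᵇ ℂ)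
  one_mem : (1 : S →ᵇ ℂ) ∈ carrier
  left_mem : ∀ (s : S) (f : S →ᵇ ℂ), f ∈ carrier → leftTranslate s f ∈ carrier
  right_mem : ∀ (s : S) (f : S →ᵇ ℂ), f ∈ carrier → rightTranslate s f ∈ carrier

variable (S) in
/-- `C_b(S)` itself. -/
def CbSpace : InvSubspace S where
  carrier := ⊤
  one_mem := trivial
  left_mem _ _ _ := trivial
  right_mem _ _ _ := trivial

variable (S) in
/-- `LUC(S)`: all `f ∈ C_b(S)` for which `s ↦ ℓ_s f` is norm continuous. -/
def LUCSpace : InvSubspace S where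
  carrier :=
    { carrier := {f | Continuous fun s => leftTranslate s f}
      add_mem' := fun {f g} hf hg => Continuous.add (f := fun s => leftTranslate s f) hf hg
      zero_mem' := (continuous_const : Continuous fun _ : S => (0 : S →ᵇ ℂ))
      smul_mem' := fun a f hf => Continuous.const_smul (g := fun s => leftTranslate s f) hf a }
  one_mem := (continuous_const : Continuous fun _ : S => (1 : S →ᵇ ℂ))
  left_mem s f hf := by
    change Continuous fun t => leftTranslate t (leftTranslate s f)
    simp only [leftTranslate_leftTranslate]
    exact Continuous.comp (g := fun t => leftTranslate t f) hf (continuous_const_mul s)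
  right_mem s f hf := by
    change Continuous fun t => leftTranslate t (rightTranslate s f)
    simp only [leftTranslate_rightTranslate]
    exact (rightTranslateCLM s).continuous.comp hf

variable (S) in
/-- `AP(S)`: all `f ∈ C_b(S)` whose left orbit `{ℓ_s f}` is relatively norm compact. -/
def APSpace : InvSubspace S where
  carrier :=
    { carrier := {f | IsCompact (closure (range fun s => leftTranslate s f))}
      add_mem' := fun {f g} hf hg => by
        refine (IsCompact.add hf hg).closure_of_subset ?_
        rintro _ ⟨s, rfl⟩
        exact Set.add_mem_add (subset_closure (mem_range_self s)) (subset_closure (mem_range_self s))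
      zero_mem' := by
        refine (isCompact_singleton (x := (0 : S →ᵇ ℂ))).closure_of_subset ?_
        rintro _ ⟨s, rfl⟩
        rfl
      smul_mem' := fun a f hf => by
        refine (IsCompact.image hf (continuous_const_smul a)).closure_of_subset ?_
        rintro _ ⟨s, rfl⟩
        exact ⟨_, subset_closure ⟨s, rfl⟩, rfl⟩ }
  one_mem := by
    refine (isCompact_singleton (x := (1 : S →ᵇ ℂ))).closure_of_subset ?_
    rintro _ ⟨s, rfl⟩
    rfl
  left_mem s f hf := by
    refine IsCompact.closure_of_subset hf ?_
    rintro _ ⟨t, rfl⟩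
    exact subset_closure ⟨s * t, (leftTranslate_leftTranslate t s f).symm⟩
  right_mem s f hf := by
    refine (IsCompact.image hf (rightTranslateCLM s).continuous).closure_of_subset ?_
    rintro _ ⟨t, rfl⟩
    exact ⟨_, subset_closure ⟨t, rfl⟩, (leftTranslate_rightTranslate t s f).symm⟩

variable (S) in
/-- `WAP(S)`: all `f ∈ C_b(S)` whose left orbit `{ℓ_s f}` is relatively compact in the weak
topology of the Banach space `C_b(S)`. -/
def WAPSpace : InvSubspace S where
  carrier :=
    { carrier :=
        {f | IsCompact (closure (range fun s => toWeakSpace ℂ (S →ᵇ ℂ) (leftTranslate s f)))}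
      add_mem' := fun {f g} hf hg => by
        refine (IsCompact.add hf hg).closure_of_subset ?_
        rintro _ ⟨s, rfl⟩
        exact Set.add_mem_add (subset_closure (mem_range_self s)) (subset_closure (mem_range_self s))
      zero_mem' := by
        refine (isCompact_singleton
          (x := toWeakSpace ℂ (S →ᵇ ℂ) (0 : S →ᵇ ℂ))).closure_of_subset ?_
        rintro _ ⟨s, rfl⟩
        rfl
      smul_mem' := fun a f hf => by
        refine (IsCompact.image hf (continuous_const_smul a)).closure_of_subset ?_
        rintro _ ⟨s, rfl⟩
        exact ⟨_, subset_closure ⟨s, rfl⟩, rfl⟩ }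
  one_mem := by
    refine (isCompact_singleton
      (x := toWeakSpace ℂ (S →ᵇ ℂ) (1 : S →ᵇ ℂ))).closure_of_subset ?_
    rintro _ ⟨s, rfl⟩
    rfl
  left_mem s f hf := by
    refine IsCompact.closure_of_subset hf ?_
    rintro _ ⟨t, rfl⟩
    exact subset_closure ⟨s * t,
      congrArg (toWeakSpace ℂ (S →ᵇ ℂ)) (leftTranslate_leftTranslate t s f).symm⟩
  right_mem s f hf := by
    refine (IsCompact.image hf
      (WeakSpace.map (rightTranslateCLM s)).continuous).closure_of_subset ?_
    rintro _ ⟨t, rfl⟩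
    exact ⟨_, subset_closure ⟨t, rfl⟩,
      congrArg (toWeakSpace ℂ (S →ᵇ ℂ)) (leftTranslate_rightTranslate t s f).symm⟩

/-- A mean on `X`: a functional `m ∈ X*` with `‖m‖ = m(1) = 1`. -/
def IsMean {X : InvSubspace S} (m : StrongDual ℂ X.carrier) : Prop :=
  ‖m‖ = 1 ∧ m ⟨1, X.one_mem⟩ = 1

/-- For a net `(m_α)` in `X*`: `m_α - ℓ_s^* m_α → 0` weak* for every `s`, where
`(ℓ_s^* m)(f) = m (ℓ_s f)`. -/
def AsympLeftInvariant {ι : Type*} [Preorder ι] {X : InvSubspace S}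
    (m : ι → StrongDual ℂ X.carrier) : Prop :=
  ∀ (s : S) (f : X.carrier),
    Tendsto (fun α => m α f - m α ⟨leftTranslate s f, X.left_mem s f f.2⟩) atTop (𝓝 0)

/-- For a net `(m_α)` in `X*`: `m_α - r_s^* m_α → 0` weak* for every `s`, where
`(r_s^* m)(f) = m (r_s f)`. -/
def AsympRightInvariant {ι : Type*} [Preorder ι] {X : InvSubspace S}
    (m : ι → StrongDual ℂ X.carrier) : Prop :=
  ∀ (s : S) (f : X.carrier),
    Tendsto (fun α => m α f - m α ⟨rightTranslate s f, X.right_mem s f f.2⟩) atTop (𝓝 0)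

variable (S) in
/-- Any two closed left ideals `closure (S a)`, `closure (S b)` meet. -/
def RightReversible : Prop :=
  ∀ a b : S, (closure (range fun s => s * a) ∩ closure (range fun s => s * b)).Nonempty

variable (S) in
/-- Any two closed right ideals `closure (a S)`, `closure (b S)` meet. -/
def LeftReversible : Prop :=
  ∀ a b : S, (closure (range fun s => a * s) ∩ closure (range fun s => b * s)).Nonempty

/-- The preorder on `S`: `a ≤ b` iff `closure (S b) ∪ {b} ⊆ closure (S a) ∪ {a}`. -/
def IdealLE (a b : S) : Prop :=
  closure (range fun s => s * b) ∪ {b} ⊆ closure (range fun s => s * a) ∪ {a}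

/-- `lim_s F(s) = y` as `s` increases in the preorder `IdealLE`. -/
def IdealTendsto {Y : Type*} [TopologicalSpace Y] (F : S → Y) (y : Y) : Prop :=
  ∀ U ∈ 𝓝 y, ∃ a : S, ∀ b : S, IdealLE a b → F b ∈ U

end FunctionSpaces

/-! ### Representations on a subset of a Hilbert space -/

section Representations

variable {S : Type*} [Semigroup S] [TopologicalSpace S] [SeparatelyContinuousMul S]
variable {H : Type*} [NormedAddCommGroup H] [InnerProductSpace ℂ H]

/-- `T_{st} = T_s ∘ T_t`. -/
def IsRepresentation {C : Set H} (T : S → C → C) : Prop :=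
  ∀ (s t : S) (x : C), T (s * t) x = T s (T t x)

/-- `(s, x) ↦ T_s x` is separately continuous (norm topology on `C`). -/
def IsSeparatelyContinuous {C : Set H} (T : S → C → C) : Prop :=
  (∀ x, Continuous fun s => T s x) ∧ ∀ s, Continuous (T s)

/-- `‖T_s x - T_s y‖ ≤ ‖x - y‖`. -/
def IsNonexpansive {C : Set H} (T : S → C → C) : Prop :=
  ∀ (s : S) (x y : C), ‖(T s x : H) - T s y‖ ≤ ‖(x : H) - y‖

/-- `A_C(𝒮)`, the set of attractive points of the representation for `C`. -/
def attractivePoints {C : Set H} (T : S → C → C) : Set H :=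
  {a | ∀ (s : S) (x : C), ‖a - T s x‖ ≤ ‖a - x‖}

/-- `(C, wk)`: the set `C` with the topology induced by the weak topology of `H`. -/
abbrev WeakSubset (C : Set H) : Type _ :=
  {z : WeakSpace ℂ H // (toWeakSpace ℂ H).symm z ∈ C}

/-- A point of `C` regarded as a point of `(C, wk)`. -/
def toWeakSubset {C : Set H} (x : C) : WeakSubset C :=
  ⟨toWeakSpace ℂ H x, x.2⟩

/-- A point of `(C, wk)` regarded as a point of `C`. -/
def ofWeakSubset {C : Set H} (z : WeakSubset C) : C :=
  ⟨(toWeakSpace ℂ H).symm z.1, z.2⟩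

/-- The map `T_s` regarded as a self map of `(C, wk)`. -/
def weakMap {C : Set H} (T : S → C → C) (s : S) (z : WeakSubset C) : WeakSubset C :=
  toWeakSubset (T s (ofWeakSubset z))

/-- `(s, x) ↦ T_s x` is jointly continuous from `S × (C, wk)` to `(C, wk)`. -/
def IsWeaklyJointlyContinuous {C : Set H} (T : S → C → C) : Prop :=
  Continuous fun p : S × WeakSubset C => weakMap T p.1 p.2

/-- The family `{T_s}` is equicontinuous on `(C, wk)`, for the uniformity of the weak topology
(generated by the seminorms `|f|`, `f ∈ H*`). -/
def IsWeaklyEquicontinuous {C : Set H} (T : S → C → C) : Prop :=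
  ∀ (x₀ : WeakSubset C) (f : StrongDual ℂ H) (ε : ℝ), 0 < ε →
    ∀ᶠ x in 𝓝 x₀, ∀ s : S,
      ‖f (T s (ofWeakSubset x) : H) - f (T s (ofWeakSubset x₀) : H)‖ < ε

/-- The closure of `{T_s}` in the product space `(C, wk)^(C, wk)` consists of continuous maps. -/
def IsWeaklyQuasiEquicontinuous {C : Set H} (T : S → C → C) : Prop :=
  ∀ g ∈ closure (range (weakMap T)), Continuous g

/-- Every orbit has its weak closure (in `H`) contained in `C`. -/
def HasOrbitClosuresIn {C : Set H} (T : S → C → C) : Prop :=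
  ∀ x : C, closure (range fun s => toWeakSpace ℂ H (T s x : H)) ⊆ toWeakSpace ℂ H '' C

/-- `u` is the point of `D` nearest to `x`. -/
def IsNearestPoint (D : Set H) (x u : H) : Prop :=
  u ∈ D ∧ ∀ d ∈ D, ‖u - x‖ ≤ ‖d - x‖

open Classical in
/-- The metric projection `P_D : H → D`, characterised by `IsNearestPoint` (such a point exists
and is unique when `D` is nonempty, closed and convex; the value is `x` if there is none). -/
def metricProj (D : Set H) (x : H) : H :=
  if h : ∃ u, IsNearestPoint D x u then h.choose else x

theorem metricProj_isNearestPoint [CompleteSpace H] {D : Set H} (hne : D.Nonempty)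
    (hcl : IsClosed D) (hco : Convex ℝ D) (x : H) : IsNearestPoint D x (metricProj D x) := by
  let _ : InnerProductSpace ℝ H := InnerProductSpace.complexToReal
  have h : ∃ u, IsNearestPoint D x u := by
    obtain ⟨v, hv, hvx⟩ := exists_norm_eq_iInf_of_complete_convex hne hcl.isComplete hco x
    refine ⟨v, hv, fun d hd => ?_⟩
    rw [norm_sub_rev v x, norm_sub_rev d x, hvx]
    exact ciInf_le (f := fun w : D => ‖x - w‖)
      ⟨0, by rintro _ ⟨w, rfl⟩; exact norm_nonneg _⟩ ⟨d, hd⟩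
  rw [metricProj, dif_pos h]
  exact h.choose_spec

/-- `z = T_m x`: for each `f ∈ H*` the function `f_x(s) = f (T_s x)` belongs to `X`, and
`f z = m (f_x)`. -/
def IsMeanPoint {C : Set H} {X : InvSubspace S} (m : StrongDual ℂ X.carrier) (T : S → C → C)
    (x : C) (z : H) : Prop :=
  ∀ f : StrongDual ℂ H, ∃ g : X.carrier, (∀ s, (g : S →ᵇ ℂ) s = f (T s x : H)) ∧ f z = m g

open Classical in
/-- The point `T_m x ∈ H`, i.e. the unique point `z` with `IsMeanPoint m T x z` (the value is `0`
if there is none). -/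
def meanPoint {C : Set H} {X : InvSubspace S} (m : StrongDual ℂ X.carrier) (T : S → C → C)
    (x : C) : H :=
  if h : ∃ z, IsMeanPoint m T x z then h.choose else 0

theorem IsMeanPoint.unique {C : Set H} {X : InvSubspace S} {m : StrongDual ℂ X.carrier}
    {T : S → C → C} {x : C} {z w : H} (hz : IsMeanPoint m T x z) (hw : IsMeanPoint m T x w) :
    z = w := by
  refine (SeparatingDual.eq_iff_forall_dual_eq (R := ℂ)).2 fun f => ?_
  obtain ⟨g, hg, hgz⟩ := hz f
  obtain ⟨g', hg', hgw⟩ := hw f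
  have : g = g' := by
    ext s
    rw [hg, hg']
  rw [hgz, hgw, this]

theorem IsMeanPoint.eq_meanPoint {C : Set H} {X : InvSubspace S} {m : StrongDual ℂ X.carrier}
    {T : S → C → C} {x : C} {z : H} (hz : IsMeanPoint m T x z) : z = meanPoint m T x := by
  have h : ∃ z, IsMeanPoint m T x z := ⟨z, hz⟩
  rw [meanPoint, dif_pos h]
  exact hz.unique h.choose_spec

end Representations

end Ergodic

end

noncomputable section

namespace Ergodic

/-! ### Compactness through ultrafilters -/

theorem isCompact_closure_range_of_ultrafilter {α Y : Type*} [TopologicalSpace Y] [T3Space Y]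
    (g : α → Y) (h : ∀ u : Ultrafilter α, ∃ y, Tendsto g u (𝓝 y)) :
    IsCompact (closure (range g)) := by
  let _ : TopologicalSpace α := ⊥
  have : DiscreteTopology α := ⟨rfl⟩
  have di : IsDenseInducing (pure : α → Ultrafilter α) := isDenseInducing_pure
  have hc : Continuous (di.extend g) := di.continuous_extend fun b => by
    obtain ⟨y, hy⟩ := h b
    exact ⟨y, hy.mono_left (ultrafilter_comap_pure_nhds b)⟩
  refine (isCompact_range hc).closure_of_subset ?_
  rintro _ ⟨a, rfl⟩
  exact ⟨pure a, di.extend_eq continuous_of_discreteTopology a⟩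

theorem tendsto_toWeakSpace_iff {α E : Type*} [NormedAddCommGroup E] [NormedSpace ℂ E]
    {l : Filter α} {g : α → E} {z : E} :
    Tendsto (fun a => toWeakSpace ℂ E (g a)) l (𝓝 (toWeakSpace ℂ E z)) ↔
      ∀ φ : StrongDual ℂ E, Tendsto (fun a => φ (g a)) l (𝓝 (φ z)) := by
  refine WeakBilin.tendsto_iff_forall_eval_tendsto (topDualPairing ℂ E).flip fun x y hxy => ?_
  exact (SeparatingDual.eq_iff_forall_dual_eq (R := ℂ)).2 fun f => LinearMap.congr_fun hxy f

/-! ### Weak compactness in spaces of continuous functions -/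

section ContinuousFunctions

variable {K : Type*} [TopologicalSpace K]

theorem nnnorm_coe_nnreal (r : NNReal) : ‖(r : ℂ)‖₊ = r := by
  ext
  simp only [coe_nnnorm, Complex.norm_real, Real.norm_eq_abs, NNReal.abs_eq]


/-- The supremum of `‖φ h‖` over all `h` with `‖h‖ ≤ g` pointwise. -/
def dominatingValue (φ : StrongDual ℂ C(K, ℂ)) (g : K → NNReal) : NNReal :=
  sSup {r : NNReal | ∃ h : C(K, ℂ), (∀ y, ‖h y‖₊ ≤ g y) ∧ ‖φ h‖₊ = r}

theorem dominatingValue_le (φ : StrongDual ℂ C(K, ℂ)) {g : K → NNReal} {M : NNReal}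
    (hM : ∀ h : C(K, ℂ), (∀ y, ‖h y‖₊ ≤ g y) → ‖φ h‖₊ ≤ M) : dominatingValue φ g ≤ M := by
  refine csSup_le ⟨_, 0, fun y => by simp, rfl⟩ ?_
  rintro _ ⟨h, hh, rfl⟩
  exact hM h hh

theorem exists_rotation (φ : StrongDual ℂ C(K, ℂ)) (h : C(K, ℂ)) :
    ∃ h' : C(K, ℂ), (∀ y, ‖h' y‖₊ = ‖h y‖₊) ∧ φ h' = (‖φ h‖₊ : ℂ) := by
  obtain ⟨a, ha, hah⟩ := RCLike.exists_norm_eq_mul_self (φ h)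
  have ha' : ‖a‖₊ = 1 := by ext; simpa using ha
  exact ⟨a • h, fun y => by simp [ha'], by rw [map_smul, smul_eq_mul, ← hah]; rfl⟩

variable [CompactSpace K]

theorem bddAbove_dominated (φ : StrongDual ℂ C(K, ℂ)) {g : K → NNReal} (hg : Continuous g) :
    BddAbove {r : NNReal | ∃ h : C(K, ℂ), (∀ y, ‖h y‖₊ ≤ g y) ∧ ‖φ h‖₊ = r} := by
  obtain ⟨M, hM⟩ := (isCompact_range hg).bddAbove
  refine ⟨‖φ‖₊ * M, ?_⟩
  rintro _ ⟨h, hh, rfl⟩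
  refine (φ.le_opNNNorm h).trans ?_
  gcongr
  exact (ContinuousMap.norm_le _ M.2).2 fun y => (hh y).trans (hM ⟨y, rfl⟩)

theorem le_dominatingValue (φ : StrongDual ℂ C(K, ℂ)) {g : K → NNReal} (hg : Continuous g)
    {h : C(K, ℂ)} (hh : ∀ y, ‖h y‖₊ ≤ g y) : ‖φ h‖₊ ≤ dominatingValue φ g :=
  le_csSup (bddAbove_dominated φ hg) ⟨h, hh, rfl⟩

theorem dominatingValue_add_le (φ : StrongDual ℂ C(K, ℂ)) {g₁ g₂ : K → NNReal}
    (hg₁ : Continuous g₁) (hg₂ : Continuous g₂) :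
    dominatingValue φ (g₁ + g₂) ≤ dominatingValue φ g₁ + dominatingValue φ g₂ := by
  refine dominatingValue_le φ fun h hh => ?_
  refine le_of_forall_pos_le_add fun ε hε => ?_
  obtain ⟨δ, hδ, hδε⟩ : ∃ δ : NNReal, 0 < δ ∧ ‖φ‖₊ * δ ≤ ε := by
    refine ⟨ε / (‖φ‖₊ + 1), by positivity, ?_⟩
    rw [mul_div_assoc', div_le_iff₀ (by positivity), mul_comm]
    gcongr
    exact le_self_add
  have hpos : ∀ y, 0 < g₁ y + g₂ y + δ := fun y => by positivity
  -- the part of `h` dominated by `g`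
  have part : ∀ g : K → NNReal, Continuous g → ∃ h' : C(K, ℂ),
      (∀ y, ‖h' y‖₊ ≤ g y) ∧ ∀ y, h' y = ((g y / (g₁ y + g₂ y + δ) : NNReal) : ℂ) * h y := by
    intro g hg
    have hc : Continuous fun y => g y / (g₁ y + g₂ y + δ) :=
      hg.div₀ ((hg₁.add hg₂).add continuous_const) fun y => (hpos y).ne'
    refine ⟨⟨fun y => ((g y / (g₁ y + g₂ y + δ) : NNReal) : ℂ) * h y, ?_⟩, fun y => ?_,
      fun y => rfl⟩
    · exact (Complex.continuous_ofReal.comp (NNReal.continuous_coe.comp hc)).mul h.continuous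
    · have := nnnorm_coe_nnreal (g y / (g₁ y + g₂ y + δ))
      simp only [ContinuousMap.coe_mk, nnnorm_mul, this]
      rw [div_mul_eq_mul_div, div_le_iff₀ (hpos y)]
      gcongr
      exact (hh y).trans le_self_add
  obtain ⟨h₁, hh₁, e₁⟩ := part g₁ hg₁
  obtain ⟨h₂, hh₂, e₂⟩ := part g₂ hg₂
  have hrest : ‖h - (h₁ + h₂)‖₊ ≤ δ := by
    refine (ContinuousMap.norm_le _ δ.2).2 fun y => ?_
    have hne : ((g₁ y : ℂ) + g₂ y + δ) ≠ 0 := by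
      have := (hpos y).ne'
      exact_mod_cast this
    have : (h - (h₁ + h₂)) y = ((δ / (g₁ y + g₂ y + δ) : NNReal) : ℂ) * h y := by
      simp only [ContinuousMap.sub_apply, ContinuousMap.add_apply, e₁, e₂]
      push_cast
      field_simp
      ring
    have hn := nnnorm_coe_nnreal (δ / (g₁ y + g₂ y + δ))
    change ‖(h - (h₁ + h₂)) y‖₊ ≤ δ
    rw [this, nnnorm_mul, hn, div_mul_eq_mul_div, div_le_iff₀ (hpos y)]
    gcongr
    exact (hh y).trans le_self_add
  have hsplit : φ h = φ h₁ + φ h₂ + φ (h - (h₁ + h₂)) := by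
    simp
  calc ‖φ h‖₊ ≤ ‖φ h₁‖₊ + ‖φ h₂‖₊ + ‖φ (h - (h₁ + h₂))‖₊ := by
        rw [hsplit]; exact (nnnorm_add_le _ _).trans (by gcongr; exact nnnorm_add_le _ _)
    _ ≤ dominatingValue φ g₁ + dominatingValue φ g₂ + ε := by
        gcongr
        · exact le_dominatingValue φ hg₁ hh₁
        · exact le_dominatingValue φ hg₂ hh₂
        · exact ((φ.le_opNNNorm _).trans (by gcongr)).trans hδε

theorem le_dominatingValue_add (φ : StrongDual ℂ C(K, ℂ)) {g₁ g₂ : K → NNReal}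
    (hg₁ : Continuous g₁) (hg₂ : Continuous g₂) :
    dominatingValue φ g₁ + dominatingValue φ g₂ ≤ dominatingValue φ (g₁ + g₂) := by
  have key : ∀ h₁ h₂ : C(K, ℂ), (∀ y, ‖h₁ y‖₊ ≤ g₁ y) → (∀ y, ‖h₂ y‖₊ ≤ g₂ y) →
      ‖φ h₁‖₊ + ‖φ h₂‖₊ ≤ dominatingValue φ (g₁ + g₂) := by
    intro h₁ h₂ hh₁ hh₂
    obtain ⟨k₁, hk₁, e₁⟩ := exists_rotation φ h₁
    obtain ⟨k₂, hk₂, e₂⟩ := exists_rotation φ h₂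
    have : ‖φ (k₁ + k₂)‖₊ = ‖φ h₁‖₊ + ‖φ h₂‖₊ := by
      rw [map_add, e₁, e₂]
      have : ((‖φ h₁‖₊ : ℂ) + (‖φ h₂‖₊ : ℂ)) = ((‖φ h₁‖₊ + ‖φ h₂‖₊ : NNReal) : ℂ) := by
        push_cast; rfl
      rw [this, nnnorm_coe_nnreal]
    rw [← this]
    refine le_dominatingValue φ (hg₁.add hg₂) fun y => (nnnorm_add_le _ _).trans ?_
    rw [hk₁, hk₂]
    exact add_le_add (hh₁ y) (hh₂ y)
  have step : ∀ h₂ : C(K, ℂ), (∀ y, ‖h₂ y‖₊ ≤ g₂ y) →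
      dominatingValue φ g₁ + ‖φ h₂‖₊ ≤ dominatingValue φ (g₁ + g₂) := fun h₂ hh₂ => by
    have h0 : ‖φ h₂‖₊ ≤ dominatingValue φ (g₁ + g₂) :=
      le_dominatingValue φ (hg₁.add hg₂) fun y => (hh₂ y).trans le_add_self
    refine (le_tsub_iff_right h0).1 (dominatingValue_le φ fun h₁ hh₁ => ?_)
    exact (le_tsub_iff_right h0).2 (key h₁ h₂ hh₁ hh₂)
  have h0 : dominatingValue φ g₁ ≤ dominatingValue φ (g₁ + g₂) :=
    dominatingValue_le φ fun h hh =>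
      le_dominatingValue φ (hg₁.add hg₂) fun y => (hh y).trans le_self_add
  refine (le_tsub_iff_left h0).1 (dominatingValue_le φ fun h₂ hh₂ => ?_)
  exact (le_tsub_iff_left h0).2 (step h₂ hh₂)

theorem mul_dominatingValue_le (φ : StrongDual ℂ C(K, ℂ)) {g : K → NNReal}
    (hg : Continuous g) (a : NNReal) :
    a * dominatingValue φ g ≤ dominatingValue φ (fun y => a * g y) := by
  rcases eq_or_ne a 0 with rfl | ha
  · simp
  rw [mul_comm, ← le_div_iff₀ (pos_iff_ne_zero.2 ha)]
  refine dominatingValue_le φ fun h hh => ?_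
  rw [le_div_iff₀ (pos_iff_ne_zero.2 ha), mul_comm]
  have ha' := nnnorm_coe_nnreal a
  have : a * ‖φ h‖₊ = ‖φ ((a : ℂ) • h)‖₊ := by rw [map_smul, nnnorm_smul, ha']
  rw [this]
  refine le_dominatingValue φ (continuous_const.mul hg) fun y => ?_
  rw [ContinuousMap.smul_apply, nnnorm_smul, ha']
  exact mul_le_mul_right (hh y) a

theorem dominatingValue_smul (φ : StrongDual ℂ C(K, ℂ)) {g : K → NNReal}
    (hg : Continuous g) (a : NNReal) :
    dominatingValue φ (fun y => a * g y) = a * dominatingValue φ g := by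
  refine le_antisymm ?_ (mul_dominatingValue_le φ hg a)
  rcases eq_or_ne a 0 with rfl | ha
  · rw [zero_mul]
    refine dominatingValue_le φ fun h hh => ?_
    have : h = 0 := by
      ext y
      simpa using hh y
    simp [this]
  · have := mul_dominatingValue_le φ (g := fun y => a * g y) (continuous_const.mul hg) a⁻¹
    have e : (fun y => a⁻¹ * (a * g y)) = g := funext fun y => inv_mul_cancel_left₀ ha _
    rw [e] at this
    rwa [inv_mul_le_iff₀ (pos_iff_ne_zero.2 ha)] at this

/-- A positive functional that dominates `φ`. -/
def dominatingFunctional (φ : StrongDual ℂ C(K, ℂ)) :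
    CompactlySupportedContinuousMap K NNReal →ₗ[NNReal] NNReal where
  toFun g := dominatingValue φ g
  map_add' g₁ g₂ := le_antisymm (dominatingValue_add_le φ g₁.continuous g₂.continuous)
    (le_dominatingValue_add φ g₁.continuous g₂.continuous)
  map_smul' a g := dominatingValue_smul φ g.continuous a

/-- A bounded pointwise null sequence in `C(K)` is weakly null. -/
theorem tendsto_dual_of_tendsto_pointwise [T2Space K] (φ : StrongDual ℂ C(K, ℂ))
    (f : ℕ → C(K, ℂ)) (R : NNReal) (hR : ∀ n y, ‖f n y‖₊ ≤ R)
    (hf : ∀ y, Tendsto (fun n => f n y) atTop (𝓝 0)) :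
    Tendsto (fun n => φ (f n)) atTop (𝓝 0) := by
  let _ : MeasurableSpace K := borel K
  have : BorelSpace K := ⟨rfl⟩
  let Λ := dominatingFunctional φ
  let ν := NNRealRMK.rieszMeasure Λ
  let g : ℕ → CompactlySupportedContinuousMap K NNReal := fun n =>
    CompactlySupportedContinuousMap.continuousMapEquiv ⟨fun y => ‖f n y‖₊, by fun_prop⟩
  have hle : ∀ n, ((‖φ (f n)‖₊ : NNReal) : ENNReal) ≤ ∫⁻ y, (‖f n y‖₊ : ENNReal) ∂ν := fun n => by
    have h1 : ∫⁻ y, (‖f n y‖₊ : ENNReal) ∂ν = Λ (g n) := NNRealRMK.lintegral_rieszMeasure Λ (g n)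
    rw [h1]
    exact ENNReal.coe_le_coe.2 (le_dominatingValue φ (g n).continuous fun y => le_rfl)
  have hlim : Tendsto (fun n => ∫⁻ y, (‖f n y‖₊ : ENNReal) ∂ν) atTop (𝓝 (∫⁻ _, 0 ∂ν)) := by
    refine MeasureTheory.tendsto_lintegral_of_dominated_convergence (fun _ => (R : ENNReal))
      (fun n => ?_) (fun n => ?_) ?_ ?_
    · exact (ENNReal.continuous_coe.comp (f n).continuous.nnnorm).measurable
    · exact Eventually.of_forall fun y => ENNReal.coe_le_coe.2 (hR n y)
    · rw [MeasureTheory.lintegral_const]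
      exact ENNReal.mul_ne_top ENNReal.coe_ne_top (isCompact_univ.measure_ne_top)
    · refine Eventually.of_forall fun y => ?_
      have := (hf y).nnnorm
      rw [nnnorm_zero] at this
      exact ENNReal.tendsto_coe.2 this
  rw [MeasureTheory.lintegral_zero] at hlim
  have h0 : Tendsto (fun n => ((‖φ (f n)‖₊ : NNReal) : ENNReal)) atTop (𝓝 ((0 : NNReal) : ENNReal)) :=
    tendsto_of_tendsto_of_tendsto_of_le_of_le tendsto_const_nhds hlim (fun _ => zero_le) hle
  rw [ENNReal.tendsto_coe] at h0
  rw [tendsto_zero_iff_norm_tendsto_zero]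
  exact NNReal.tendsto_coe.2 h0

theorem exists_finite_net {α : Type*} (G : α → C(K, ℂ)) (A : Finset α) {ε : ℝ} (hε : 0 < ε) :
    ∃ N : Finset K, ∀ y, ∃ x ∈ N, ∀ a ∈ A, ‖G a x - G a y‖ < ε := by
  obtain ⟨N, hN⟩ := CompactSpace.elim_nhds_subcover
    (fun x : K => {y | ∀ a ∈ A, ‖G a x - G a y‖ < ε}) fun x => by
      refine (eventually_all_finset A).2 fun a _ => ?_
      have : ContinuousAt (fun y => ‖G a x - G a y‖) x := by fun_prop
      exact this.eventually_lt_const (by simpa using hε)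
  refine ⟨N, fun y => ?_⟩
  have : y ∈ ⋃ x ∈ N, {y | ∀ a ∈ A, ‖G a x - G a y‖ < ε} := hN ▸ mem_univ y
  simpa using this

/-- If `0` is a pointwise cluster point of a family whose pointwise limits along ultrafilters are
all continuous, then a sequence in the family tends to `0` pointwise. -/
theorem exists_seq_tendsto_zero {α : Type*} (G : α → C(K, ℂ)) (V : Set α)
    (hlim : ∀ u : Ultrafilter α, ∃ g : C(K, ℂ), ∀ y, Tendsto (fun a => G a y) u (𝓝 (g y)))
    (hV : ∀ (N : Finset K) (ε : ℝ), 0 < ε → ∃ a ∈ V, ∀ x ∈ N, ‖G a x‖ < ε) :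
    ∃ s : ℕ → α, (∀ n, s n ∈ V) ∧ ∀ y, Tendsto (fun n => G (s n) y) atTop (𝓝 0) := by
  classical
  -- a state is (chosen index, previously chosen indices, net, stage)
  let St := α × Finset α × Finset K × ℕ
  obtain ⟨q, hq, hr⟩ := exists_seq_of_forall_finset_exists
    (fun p : St => p.1 ∈ V ∧ ∀ y, ∃ x ∈ p.2.2.1, ∀ a ∈ p.2.1,
      ‖G a x - G a y‖ < 1 / ((p.2.2.2 : ℝ) + 1))
    (fun p p' : St => p.1 ∈ p'.2.1 ∧ p.2.2.2 < p'.2.2.2 ∧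
      ∀ x ∈ p.2.2.1, ‖G p'.1 x‖ < 1 / ((p'.2.2.2 : ℝ) + 1))
    (by
      intro F _
      let A : Finset α := F.image fun p => p.1
      let k : ℕ := F.sup (fun p => p.2.2.2) + 1
      have hk : (0 : ℝ) < 1 / ((k : ℝ) + 1) := by positivity
      obtain ⟨N, hN⟩ := exists_finite_net G A hk
      obtain ⟨a, haV, ha⟩ := hV (F.biUnion fun p => p.2.2.1) _ hk
      refine ⟨(a, A, N, k), ⟨haV, hN⟩, fun p hp => ⟨Finset.mem_image_of_mem _ hp, ?_, ?_⟩⟩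
      · exact Nat.lt_succ_of_le (Finset.le_sup (f := fun p : St => p.2.2.2) hp)
      · exact fun x hx => ha x (Finset.mem_biUnion.2 ⟨p, hp, hx⟩))
  have hmono : StrictMono fun n => (q n).2.2.2 := strictMono_nat_of_lt_succ fun n =>
    (hr n (n + 1) n.lt_succ_self).2.1
  have hsmall : Tendsto (fun n => 1 / (((q n).2.2.2 : ℝ) + 1)) atTop (𝓝 0) :=
    tendsto_one_div_add_atTop_nhds_zero_nat.comp hmono.tendsto_atTop
  refine ⟨fun n => (q n).1, fun n => (hq n).1, fun y => ?_⟩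
  rw [tendsto_iff_ultrafilter]
  intro w hw
  obtain ⟨g, hg⟩ := hlim (w.map fun n => (q n).1)
  have hg' : ∀ x, Tendsto (fun n => G (q n).1 x) w (𝓝 (g x)) := hg
  choose x hxN hx using fun n => (hq n).2 y
  obtain ⟨z, -, hz⟩ := isCompact_univ.ultrafilter_le_nhds (w.map x) (by simp)
  have hz : Tendsto x w (𝓝 z) := hz
  have hGz : ∀ i, G (q i).1 z = G (q i).1 y := fun i => by
    refine tendsto_nhds_unique (((G (q i).1).continuous.tendsto z).comp hz) ?_
    rw [tendsto_iff_norm_sub_tendsto_zero]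
    refine squeeze_zero' (Eventually.of_forall fun _ => norm_nonneg _) ?_ (hsmall.mono_left hw)
    filter_upwards [hw (eventually_gt_atTop i)] with n hn
    exact (hx n _ (hr i n hn).1).le
  have hgx : ∀ n, g (x n) = 0 := fun n => by
    refine tendsto_nhds_unique (hg' (x n)) ?_
    rw [tendsto_zero_iff_norm_tendsto_zero]
    refine squeeze_zero' (Eventually.of_forall fun _ => norm_nonneg _) ?_ (hsmall.mono_left hw)
    filter_upwards [hw (eventually_gt_atTop n)] with m hm
    exact ((hr n m hm).2.2 _ (hxN n)).le
  have hgz : g z = 0 := by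
    refine tendsto_nhds_unique ((g.continuous.tendsto z).comp hz) ?_
    simp only [Function.comp_def, hgx]
    exact tendsto_const_nhds
  have := hg' z
  simp only [hGz, hgz] at this
  exact this

/-- A bounded family in `C(K)` all of whose pointwise limits are continuous is relatively weakly
compact. -/
theorem isCompact_closure_range_toWeakSpace [T2Space K] {α : Type*} (F : α → C(K, ℂ)) (R : ℝ)
    (hR : ∀ a y, ‖F a y‖ ≤ R)
    (hlim : ∀ u : Ultrafilter α, ∃ g : C(K, ℂ), ∀ y, Tendsto (fun a => F a y) u (𝓝 (g y))) :
    IsCompact (closure (range fun a => toWeakSpace ℂ C(K, ℂ) (F a))) := by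
  refine isCompact_closure_range_of_ultrafilter _ fun u => ?_
  obtain ⟨h, hh⟩ := hlim u
  refine ⟨toWeakSpace ℂ C(K, ℂ) h, tendsto_toWeakSpace_iff.2 fun φ => ?_⟩
  by_contra hcon
  rw [Metric.tendsto_nhds] at hcon
  push Not at hcon
  obtain ⟨δ, hδ, hcon⟩ := hcon
  set V : Set α := {a | δ ≤ ‖φ (F a - h)‖} with hVdef
  have hVu : V ∈ u := by
    filter_upwards [hcon] with a ha
    rwa [hVdef, mem_ofPred_eq, map_sub, ← dist_eq_norm]
  have hG : ∀ y, Tendsto (fun a => (F a - h) y) u (𝓝 0) := fun y => by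
    simpa using (hh y).sub_const (h y)
  obtain ⟨s, hsV, hs⟩ := exists_seq_tendsto_zero (fun a => F a - h) V
    (fun v => by
      obtain ⟨g, hg⟩ := hlim v
      exact ⟨g - h, fun y => (hg y).sub_const (h y)⟩)
    (fun N ε hε => by
      have : ∀ᶠ a in u, ∀ x ∈ N, ‖(F a - h) x‖ < ε := (eventually_all_finset N).2 fun x _ => by
        have := (hG x).norm
        rw [norm_zero] at this
        exact this.eventually_lt_const hε
      obtain ⟨a, ha, ha'⟩ := (this.and hVu).exists
      exact ⟨a, ha', ha⟩)
  have hφ := tendsto_dual_of_tendsto_pointwise φ (fun n => F (s n) - h) (R.toNNReal + ‖h‖₊)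
    (fun n y => by
      refine (nnnorm_sub_le _ _).trans (add_le_add ?_ (h.norm_coe_le_norm y))
      exact NNReal.le_toNNReal_of_coe_le (hR _ _)) hs
  rw [tendsto_zero_iff_norm_tendsto_zero] at hφ
  obtain ⟨n, hn⟩ := (hφ.eventually_lt_const hδ).exists
  exact absurd (hsV n) (not_le.2 hn)

end ContinuousFunctions

/-! ### Weak compactness of bounded orbits -/

section WeakOrbits

theorem exists_orbit_bound {S E : Type*} [NormedAddCommGroup E] {C : Set E} {T : S → C → C}
    (hTne : IsNonexpansive T) {c : C}
    (hc : Bornology.IsBounded (range fun s => (T s c : E))) (x : C) :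
    ∃ R : ℝ, 0 ≤ R ∧ ∀ s, ‖(T s x : E)‖ ≤ R := by
  obtain ⟨R, hR⟩ := hc.exists_norm_le
  refine ⟨max R 0 + ‖(x : E) - c‖, by positivity, fun s => ?_⟩
  have h1 : ‖(T s c : E)‖ ≤ max R 0 := (hR _ ⟨s, rfl⟩).trans (le_max_left _ _)
  calc ‖(T s x : E)‖ = ‖(T s c : E) + (T s x - T s c)‖ := by rw [add_sub_cancel]
    _ ≤ ‖(T s c : E)‖ + ‖(T s x : E) - T s c‖ := norm_add_le _ _
    _ ≤ _ := add_le_add h1 (hTne s x c)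

variable {H : Type*} [NormedAddCommGroup H] [InnerProductSpace ℂ H]

theorem exists_tendsto_toWeakSpace_of_bounded [CompleteSpace H] {α : Type*} {g : α → H} {R : ℝ}
    (hR : ∀ a, ‖g a‖ ≤ R) (u : Ultrafilter α) :
    ∃ z : H, Tendsto (fun a => toWeakSpace ℂ H (g a)) u (𝓝 (toWeakSpace ℂ H z)) := by
  obtain ⟨ψ, -, hψ⟩ := (WeakDual.isCompact_closedBall (0 : StrongDual ℂ H) R).ultrafilter_le_nhds
    (u.map fun a => StrongDual.toWeakDual (InnerProductSpace.toDual ℂ H (g a))) (by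
      rw [le_principal_iff]
      refine Ultrafilter.mem_map.2 (Eventually.of_forall fun a => ?_)
      have : ‖InnerProductSpace.toDual ℂ H (g a)‖ ≤ R := by simpa using hR a
      simpa using this)
  have hψ' : ∀ v, Tendsto (fun a => inner ℂ (g a) v) u (𝓝 (ψ v)) := fun v =>
    ((WeakDual.eval_continuous v).tendsto ψ).comp hψ
  refine ⟨(InnerProductSpace.toDual ℂ H).symm (WeakDual.toStrongDual ψ),
    tendsto_toWeakSpace_iff.2 fun φ => ?_⟩
  have hφ : ∀ w, φ w = starRingEnd ℂ (inner ℂ w ((InnerProductSpace.toDual ℂ H).symm φ)) := by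
    intro w
    rw [inner_conj_symm, InnerProductSpace.toDual_symm_apply]
  simp only [hφ]
  refine (Complex.continuous_conj.tendsto _).comp ?_
  rw [InnerProductSpace.toDual_symm_apply]
  exact hψ' _

variable {S : Type*} {C : Set H} {T : S → C → C}

/-- The closure of the orbit of `x` in `(C, wk)`. -/
def weakOrbit (T : S → C → C) (x : C) : Set (WeakSubset C) :=
  closure (range fun s => toWeakSubset (T s x))

theorem isCompact_weakOrbit [CompleteSpace H] (hcl : HasOrbitClosuresIn T) {x : C} {R : ℝ}
    (hR : ∀ s, ‖(T s x : H)‖ ≤ R) : IsCompact (weakOrbit T x) := by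
  have hK : IsCompact (closure (range fun s => toWeakSpace ℂ H (T s x : H))) :=
    isCompact_closure_range_of_ultrafilter _ fun u =>
      (exists_tendsto_toWeakSpace_of_bounded hR u).imp' _ fun _ h => h
  have e : weakOrbit T x =
      Subtype.val ⁻¹' closure (range fun s => toWeakSpace ℂ H (T s x : H)) := by
    rw [weakOrbit, IsEmbedding.subtypeVal.closure_eq_preimage_closure_image, ← range_comp]
    rfl
  rw [e]
  refine IsEmbedding.subtypeVal.isInducing.isCompact_preimage' hK fun z hz => ?_
  obtain ⟨y, hy, rfl⟩ := hcl x hz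
  exact ⟨⟨toWeakSpace ℂ H y, hy⟩, rfl⟩

theorem continuous_dual_ofWeakSubset (f : StrongDual ℂ H) :
    Continuous fun z : WeakSubset C => f (ofWeakSubset z : H) :=
  (WeakBilin.eval_continuous (topDualPairing ℂ H).flip f).comp continuous_subtype_val

theorem continuous_toWeakSubset : Continuous (toWeakSubset : C → WeakSubset C) :=
  ((toWeakSpaceCLM ℂ H).continuous.comp continuous_subtype_val).subtype_mk _

theorem continuous_weakMap_of_equicontinuous (he : IsWeaklyEquicontinuous T) (s : S) :
    Continuous (weakMap T s) := by
  refine Continuous.subtype_mk ?_ _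
  rw [continuous_iff_continuousAt]
  intro z
  refine tendsto_toWeakSpace_iff.2 fun f => ?_
  rw [Metric.tendsto_nhds]
  intro ε hε
  filter_upwards [he z f ε hε] with y hy
  rw [dist_eq_norm]
  exact hy s

end WeakOrbits

/-! ### Coefficient functions of a representation -/

section Coefficients

variable {S : Type*} [TopologicalSpace S]

/-- Composition with a continuous map, as a bounded operator. -/
def pullbackCLM {K : Type*} [TopologicalSpace K] (e : C(S, K)) : (K →ᵇ ℂ) →L[ℂ] (S →ᵇ ℂ) :=
  LinearMap.mkContinuous
    { toFun := fun h => h.compContinuous e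
      map_add' := fun _ _ => rfl
      map_smul' := fun _ _ => rfl } 1 fun h => by
    rw [one_mul]
    exact (BoundedContinuousFunction.norm_le (norm_nonneg h)).2 fun t => h.norm_coe_le_norm _

variable {H : Type*} [NormedAddCommGroup H] [InnerProductSpace ℂ H] {C : Set H} {T : S → C → C}

theorem exists_coefficient (hTcont : IsSeparatelyContinuous T) {x : C} {R : ℝ}
    (hR : ∀ s, ‖(T s x : H)‖ ≤ R) (f : StrongDual ℂ H) :
    ∃ g : S →ᵇ ℂ, ∀ s, g s = f (T s x : H) :=
  ⟨BoundedContinuousFunction.ofNormedAddCommGroup (fun s => f (T s x : H))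
    (f.continuous.comp (continuous_subtype_val.comp (hTcont.1 x))) (‖f‖ * R)
    fun s => (f.le_opNorm _).trans (by gcongr; exact hR s), fun _ => rfl⟩

/-- The orbit map of `x` into its closure in `(C, wk)`. -/
def orbitMap (hTcont : IsSeparatelyContinuous T) (x : C) : C(S, weakOrbit T x) :=
  ⟨fun s => ⟨toWeakSubset (T s x), subset_closure ⟨s, rfl⟩⟩,
    (continuous_toWeakSubset.comp (hTcont.1 x)).subtype_mk _⟩

theorem denseRange_orbitMap (hTcont : IsSeparatelyContinuous T) (x : C) :
    DenseRange (orbitMap hTcont x) := by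
  intro z
  rw [IsEmbedding.subtypeVal.closure_eq_preimage_closure_image, ← range_comp]
  exact z.2

/-- The function `y ↦ f (T_s y)` on the closed weak orbit of `x`. -/
def orbitFunction (T : S → C → C) (hw : ∀ s, Continuous (weakMap T s)) (f : StrongDual ℂ H) (x : C)
    (s : S) : C(weakOrbit T x, ℂ) :=
  ⟨fun z => f (T s (ofWeakSubset z.1) : H),
    (continuous_dual_ofWeakSubset f).comp ((hw s).comp continuous_subtype_val)⟩

variable [Semigroup S]

theorem norm_orbitFunction_le (hT : IsRepresentation T) (hTcont : IsSeparatelyContinuous T)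
    (hw : ∀ s, Continuous (weakMap T s)) {x : C} {R : ℝ} (hR : ∀ s, ‖(T s x : H)‖ ≤ R)
    (f : StrongDual ℂ H) (s : S) (z : weakOrbit T x) :
    ‖orbitFunction T hw f x s z‖ ≤ ‖f‖ * R := by
  refine (denseRange_orbitMap hTcont x).induction_on
    (p := fun z => ‖orbitFunction T hw f x s z‖ ≤ ‖f‖ * R) z
    (isClosed_le (orbitFunction T hw f x s).continuous.norm continuous_const) fun t => ?_
  change ‖f (T s (T t x) : H)‖ ≤ _
  rw [← hT]
  exact (f.le_opNorm _).trans (by gcongr; exact hR _)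

variable [SeparatelyContinuousMul S]

theorem leftTranslate_eq_pullback (hT : IsRepresentation T) (hTcont : IsSeparatelyContinuous T)
    (hw : ∀ s, Continuous (weakMap T s)) {f : StrongDual ℂ H} {x : C} [CompactSpace (weakOrbit T x)]
    {g : S →ᵇ ℂ} (hg : ∀ s, g s = f (T s x : H)) (s : S) :
    leftTranslate s g = pullbackCLM (orbitMap hTcont x)
      (ContinuousMap.linearIsometryBoundedOfCompact _ ℂ ℂ (orbitFunction T hw f x s)) := by
  ext t
  rw [leftTranslate_apply, hg, hT]
  rfl

variable [CompleteSpace H]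

theorem coefficient_mem_LUC (hT : IsRepresentation T) (hTcont : IsSeparatelyContinuous T)
    (hcl : HasOrbitClosuresIn T) (hj : IsWeaklyJointlyContinuous T) {x : C} {R : ℝ}
    (hR : ∀ s, ‖(T s x : H)‖ ≤ R) {f : StrongDual ℂ H} {g : S →ᵇ ℂ}
    (hg : ∀ s, g s = f (T s x : H)) : g ∈ (LUCSpace S).carrier := by
  have : CompactSpace (weakOrbit T x) := isCompact_iff_compactSpace.1 (isCompact_weakOrbit hcl hR)
  have hw : ∀ s, Continuous (weakMap T s) := fun s =>
    Continuous.comp (g := fun p : S × WeakSubset C => weakMap T p.1 p.2) hj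
      (Continuous.prodMk_right s)
  change Continuous fun s => leftTranslate s g
  simp only [leftTranslate_eq_pullback hT hTcont hw hg]
  refine (pullbackCLM (orbitMap hTcont x)).continuous.comp
    ((LinearIsometryEquiv.continuous _).comp ?_)
  let Φ : C(S × weakOrbit T x, ℂ) :=
    ⟨fun p => f (ofWeakSubset (weakMap T p.1 p.2) : H), (continuous_dual_ofWeakSubset f).comp
      (Continuous.comp (g := fun p : S × WeakSubset C => weakMap T p.1 p.2) hj
        (continuous_fst.prodMk (continuous_subtype_val.comp continuous_snd)))⟩
  exact (ContinuousMap.curry Φ).continuous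

theorem coefficient_mem_AP (hT : IsRepresentation T) (hTcont : IsSeparatelyContinuous T)
    (hcl : HasOrbitClosuresIn T) (he : IsWeaklyEquicontinuous T) {x : C} {R : ℝ}
    (hR : ∀ s, ‖(T s x : H)‖ ≤ R) {f : StrongDual ℂ H} {g : S →ᵇ ℂ}
    (hg : ∀ s, g s = f (T s x : H)) : g ∈ (APSpace S).carrier := by
  have : CompactSpace (weakOrbit T x) := isCompact_iff_compactSpace.1 (isCompact_weakOrbit hcl hR)
  have hw := continuous_weakMap_of_equicontinuous he
  let F : S → weakOrbit T x →ᵇ ℂ := fun s =>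
    ContinuousMap.linearIsometryBoundedOfCompact _ ℂ ℂ (orbitFunction T hw f x s)
  have hcomp : IsCompact (closure (range F)) := by
    refine BoundedContinuousFunction.arzela_ascoli (Metric.closedBall 0 (‖f‖ * R))
      (isCompact_closedBall _ _) _ ?_ ?_
    · rintro _ z ⟨s, rfl⟩
      rw [mem_closedBall_zero_iff]
      exact norm_orbitFunction_le hT hTcont hw hR f s z
    · intro z
      rw [Metric.equicontinuousAt_iff_right]
      intro ε hε
      filter_upwards [continuous_subtype_val.continuousAt.eventually (he z.1 f ε hε)] with y hy
      rintro ⟨_, s, rfl⟩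
      rw [dist_comm, dist_eq_norm]
      exact hy s
  refine (hcomp.image (pullbackCLM (orbitMap hTcont x)).continuous).closure_of_subset ?_
  rintro _ ⟨s, rfl⟩
  exact ⟨F s, subset_closure ⟨s, rfl⟩, (leftTranslate_eq_pullback hT hTcont hw hg s).symm⟩

theorem coefficient_mem_WAP (hT : IsRepresentation T) (hTcont : IsSeparatelyContinuous T)
    (hbd : ∀ x, ∃ R : ℝ, ∀ s, ‖(T s x : H)‖ ≤ R)
    (hcl : HasOrbitClosuresIn T) (hq : IsWeaklyQuasiEquicontinuous T) {x : C}
    {f : StrongDual ℂ H} {g : S →ᵇ ℂ}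
    (hg : ∀ s, g s = f (T s x : H)) : g ∈ (WAPSpace S).carrier := by
  obtain ⟨R, hR⟩ := hbd x
  have : CompactSpace (weakOrbit T x) := isCompact_iff_compactSpace.1 (isCompact_weakOrbit hcl hR)
  have hw : ∀ s, Continuous (weakMap T s) := fun s => hq _ (subset_closure ⟨s, rfl⟩)
  let F : S → C(weakOrbit T x, ℂ) := orbitFunction T hw f x
  have hcomp : IsCompact (closure (range fun s => toWeakSpace ℂ C(weakOrbit T x, ℂ) (F s))) := by
    refine isCompact_closure_range_toWeakSpace F (‖f‖ * R)
      (norm_orbitFunction_le hT hTcont hw hR f) fun u => ?_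
    have hlim : ∀ z : WeakSubset C, ∃ w, Tendsto (fun s => weakMap T s z) u (𝓝 w) := fun z => by
      obtain ⟨R', hR'⟩ := hbd (ofWeakSubset z)
      obtain ⟨w, -, hw⟩ := (isCompact_weakOrbit hcl hR').ultrafilter_le_nhds
        (u.map fun s => weakMap T s z) (by
          rw [le_principal_iff]
          exact Ultrafilter.mem_map.2 (Eventually.of_forall fun s => subset_closure ⟨s, rfl⟩))
      exact ⟨w, hw⟩
    choose k hk using hlim
    have hkc : Continuous k := hq k (mem_closure_of_tendsto (tendsto_pi_nhds.2 hk)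
      (Eventually.of_forall fun s => ⟨s, rfl⟩))
    refine ⟨⟨fun z => f (ofWeakSubset (k z) : H), (continuous_dual_ofWeakSubset f).comp
      (hkc.comp continuous_subtype_val)⟩, fun z => ?_⟩
    exact ((continuous_dual_ofWeakSubset f).tendsto (k z)).comp (hk z)
  let P : C(weakOrbit T x, ℂ) →L[ℂ] (S →ᵇ ℂ) := (pullbackCLM (orbitMap hTcont x)).comp
    (ContinuousMap.linearIsometryBoundedOfCompact
      (weakOrbit T x) ℂ ℂ).toContinuousLinearEquiv.toContinuousLinearMap
  refine (hcomp.image (WeakSpace.map P).continuous).closure_of_subset ?_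
  rintro _ ⟨s, rfl⟩
  exact ⟨toWeakSpace ℂ _ (F s), subset_closure ⟨s, rfl⟩, congrArg (toWeakSpace ℂ (S →ᵇ ℂ))
    (leftTranslate_eq_pullback hT hTcont hw hg s).symm⟩

end Coefficients

theorem re_inner_comm {H : Type*} [NormedAddCommGroup H] [InnerProductSpace ℂ H] (v w : H) :
    (inner ℂ v w).re = (inner ℂ w v).re :=
  inner_re_symm (𝕜 := ℂ) v w

theorem norm_sub_sq_eq {H : Type*} [NormedAddCommGroup H] [InnerProductSpace ℂ H] (v w : H) :
    ‖v - w‖ ^ 2 = ‖v‖ ^ 2 - 2 * (inner ℂ w v).re + ‖w‖ ^ 2 := by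
  rw [re_inner_comm]
  exact norm_sub_sq (𝕜 := ℂ) v w

theorem tendsto_norm_sub_of_tendsto_strongDual {ι E : Type*} [SeminormedAddCommGroup E]
    [NormedSpace ℂ E] {l : Filter ι} {μ : ι → StrongDual ℂ E} {m : StrongDual ℂ E}
    (h : Tendsto μ l (𝓝 m)) : Tendsto (fun α => ‖μ α - m‖) l (𝓝 0) :=
  tendsto_iff_norm_sub_tendsto_zero.1 h

/-! ### Means -/

section Means

variable {S : Type*} [Semigroup S] [TopologicalSpace S] [SeparatelyContinuousMul S]
variable {X : InvSubspace S}

/-- Invariance of `m ∈ X*` under left translations. -/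
def IsLeftInvariant (m : StrongDual ℂ X.carrier) : Prop :=
  ∀ (s : S) (f : X.carrier), m ⟨leftTranslate s f, X.left_mem s f f.2⟩ = m f

/-- Invariance of `m ∈ X*` under right translations. -/
def IsRightInvariant (m : StrongDual ℂ X.carrier) : Prop :=
  ∀ (s : S) (f : X.carrier), m ⟨rightTranslate s f, X.right_mem s f f.2⟩ = m f

theorem norm_le_of_forall (f : X.carrier) {M : ℝ} (hM : 0 ≤ M)
    (h : ∀ t, ‖(f : S →ᵇ ℂ) t‖ ≤ M) : ‖f‖ ≤ M :=
  (BoundedContinuousFunction.norm_le hM).2 h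

theorem IsMean.nonempty {m : StrongDual ℂ X.carrier} (hm : IsMean m) : Nonempty S := by
  by_contra hS
  rw [not_nonempty_iff] at hS
  have : (⟨1, X.one_mem⟩ : X.carrier) = 0 := Subtype.ext (by ext t; exact hS.elim t)
  have h := hm.2
  rw [this, map_zero] at h
  exact zero_ne_one h

theorem IsMean.re_nonneg {m : StrongDual ℂ X.carrier} (hm : IsMean m) (f : X.carrier)
    (h : ∀ t, 0 ≤ ((f : S →ᵇ ℂ) t).re) : 0 ≤ (m f).re := by
  have key : ∀ r : ℝ, 0 < r → -(‖f‖ ^ 2 / (2 * r)) ≤ (m f).re := by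
    intro r hr
    let e : X.carrier := (r : ℂ) • ⟨1, X.one_mem⟩ - f
    have he : ‖e‖ ≤ r + ‖f‖ ^ 2 / (2 * r) := by
      refine norm_le_of_forall e (by positivity) fun t => ?_
      have hft : ‖(f : S →ᵇ ℂ) t‖ ≤ ‖f‖ := (f : S →ᵇ ℂ).norm_coe_le_norm t
      have e1 : ‖(e : S →ᵇ ℂ) t‖ ^ 2 =
          r ^ 2 - 2 * r * ((f : S →ᵇ ℂ) t).re + ‖(f : S →ᵇ ℂ) t‖ ^ 2 := by
        have : (e : S →ᵇ ℂ) t = (r : ℂ) - (f : S →ᵇ ℂ) t := by simp [e]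
        rw [this, ← Complex.normSq_eq_norm_sq, ← Complex.normSq_eq_norm_sq, Complex.normSq_apply,
          Complex.normSq_apply]
        simp
        ring
      have e2 : (r + ‖f‖ ^ 2 / (2 * r)) ^ 2 = r ^ 2 + ‖f‖ ^ 2 + (‖f‖ ^ 2 / (2 * r)) ^ 2 := by
        field_simp
        ring
      refine le_of_sq_le_sq ?_ (by positivity)
      rw [e1, e2]
      have : 0 ≤ 2 * r * ((f : S →ᵇ ℂ) t).re := mul_nonneg (by positivity) (h t)
      have : ‖(f : S →ᵇ ℂ) t‖ ^ 2 ≤ ‖f‖ ^ 2 := by gcongr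
      have : 0 ≤ (‖f‖ ^ 2 / (2 * r)) ^ 2 := by positivity
      linarith
    have h1 : m e = r - m f := by
      simp only [e, map_sub, map_smul, hm.2, smul_eq_mul, mul_one]
    have h2 : r - (m f).re ≤ r + ‖f‖ ^ 2 / (2 * r) := by
      calc r - (m f).re = (m e).re := by rw [h1]; simp
        _ ≤ ‖m e‖ := Complex.re_le_norm _
        _ ≤ ‖m‖ * ‖e‖ := m.le_opNorm e
        _ ≤ _ := by rw [hm.1, one_mul]; exact he
    linarith
  have hlim : Tendsto (fun r : ℝ => -(‖f‖ ^ 2 / (2 * r))) atTop (𝓝 (-0)) :=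
    (tendsto_const_nhds.div_atTop (tendsto_id.const_mul_atTop two_pos)).neg
  rw [neg_zero] at hlim
  exact le_of_tendsto hlim ((eventually_gt_atTop 0).mono key)

theorem IsMean.re_le {m : StrongDual ℂ X.carrier} (hm : IsMean m) (f : X.carrier) {M : ℝ}
    (h : ∀ t, ((f : S →ᵇ ℂ) t).re ≤ M) : (m f).re ≤ M := by
  have := hm.re_nonneg ((M : ℂ) • ⟨1, X.one_mem⟩ - f) fun t => by simpa using h t
  rw [map_sub, map_smul, hm.2] at this
  simpa using this

theorem exists_invariant_mean_of_ultrafilter {ι : Type*} [Preorder ι]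
    {μ : ι → StrongDual ℂ X.carrier} (hμ : ∀ α, IsMean (μ α)) (hμl : AsympLeftInvariant μ)
    (hμr : AsympRightInvariant μ) {u : Ultrafilter ι} (hu : (u : Filter ι) ≤ atTop) :
    ∃ m : StrongDual ℂ X.carrier, IsMean m ∧ IsLeftInvariant m ∧ IsRightInvariant m ∧
      ∀ f, Tendsto (fun α => μ α f) u (𝓝 (m f)) := by
  obtain ⟨ψ, hψ, hlim⟩ := (WeakDual.isCompact_closedBall (0 : StrongDual ℂ X.carrier)
    1).ultrafilter_le_nhds (u.map fun α => StrongDual.toWeakDual (μ α)) (by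
      rw [le_principal_iff]
      refine Ultrafilter.mem_map.2 (Eventually.of_forall fun α => ?_)
      simpa using (hμ α).1.le)
  let m : StrongDual ℂ X.carrier := WeakDual.toStrongDual ψ
  have hm : ∀ f, Tendsto (fun α => μ α f) u (𝓝 (m f)) := fun f =>
    ((WeakDual.eval_continuous f).tendsto ψ).comp hlim
  have hm1 : m ⟨1, X.one_mem⟩ = 1 := by
    refine tendsto_nhds_unique (hm _) ?_
    simp only [(hμ _).2]
    exact tendsto_const_nhds
  refine ⟨m, ⟨le_antisymm (by simpa using hψ) ?_, hm1⟩, fun s f => ?_, fun s f => ?_, hm⟩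
  · have h1 : ‖(⟨1, X.one_mem⟩ : X.carrier)‖ ≤ 1 :=
      norm_le_of_forall _ zero_le_one fun t => by simp
    have h2 := m.le_opNorm ⟨1, X.one_mem⟩
    rw [hm1, norm_one] at h2
    exact h2.trans (mul_le_of_le_one_right (norm_nonneg _) h1)
  · have h := tendsto_nhds_unique ((hm f).sub (hm ⟨leftTranslate s f, X.left_mem s f f.2⟩))
      ((hμl s f).mono_left hu)
    exact (sub_eq_zero.1 h).symm
  · have h := tendsto_nhds_unique ((hm f).sub (hm ⟨rightTranslate s f, X.right_mem s f f.2⟩))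
      ((hμr s f).mono_left hu)
    exact (sub_eq_zero.1 h).symm

/-! ### The points `T_m x` -/

variable {H : Type*} [NormedAddCommGroup H] [InnerProductSpace ℂ H] {C : Set H} {T : S → C → C}
variable {x : C} {R : ℝ}

theorem isMeanPoint_meanPoint [CompleteSpace H] (m : StrongDual ℂ X.carrier)
    (hco : ∀ f : StrongDual ℂ H, ∃ g : X.carrier, ∀ s, (g : S →ᵇ ℂ) s = f (T s x : H))
    (hR0 : 0 ≤ R) (hR : ∀ s, ‖(T s x : H)‖ ≤ R) : IsMeanPoint m T x (meanPoint m T x) := by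
  suffices h : ∃ z, IsMeanPoint m T x z by
    obtain ⟨z, hz⟩ := h
    rwa [← hz.eq_meanPoint]
  choose g hg using hco
  let D := InnerProductSpace.toDual ℂ H
  let L : H →L[ℂ] ℂ := LinearMap.mkContinuous
    { toFun := fun v => starRingEnd ℂ (m (g (D v)))
      map_add' := fun v w => by
        have : g (D (v + w)) = g (D v) + g (D w) := by
          ext s
          simp [hg]
        rw [this, map_add, map_add]
      map_smul' := fun a v => by
        have : g (D (a • v)) = starRingEnd ℂ a • g (D v) := by
          ext s
          simp only [hg, D.map_smulₛₗ, Submodule.coe_smul, BoundedContinuousFunction.coe_smul]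
          rfl
        rw [this, map_smul, smul_eq_mul, map_mul, Complex.conj_conj]
        rfl } (‖m‖ * R) fun v => by
    have : ‖g (D v)‖ ≤ ‖v‖ * R := norm_le_of_forall _ (by positivity) fun t => by
      rw [hg, InnerProductSpace.toDual_apply_apply]
      exact (norm_inner_le_norm _ _).trans (by gcongr; exact hR t)
    change ‖starRingEnd ℂ (m (g (D v)))‖ ≤ _
    rw [RCLike.norm_conj]
    calc ‖m (g (D v))‖ ≤ ‖m‖ * (‖v‖ * R) := (m.le_opNorm _).trans (by gcongr)
      _ = _ := by ring
  refine ⟨D.symm L, fun f => ⟨g f, hg f, ?_⟩⟩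
  obtain ⟨v, rfl⟩ := D.surjective f
  rw [InnerProductSpace.toDual_apply_apply, ← inner_conj_symm, InnerProductSpace.toDual_symm_apply]
  exact Complex.conj_conj _

theorem IsMeanPoint.apply_eq {m : StrongDual ℂ X.carrier} {z : H} (hz : IsMeanPoint m T x z)
    (f : StrongDual ℂ H) (g : X.carrier) (hg : ∀ s, (g : S →ᵇ ℂ) s = f (T s x : H)) :
    f z = m g := by
  obtain ⟨g', hg', h⟩ := hz f
  have : g = g' := by
    ext s
    rw [hg, hg']
  rw [h, this]

theorem norm_sub_le_of_isMeanPoint {m m' : StrongDual ℂ X.carrier} {z z' : H}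
    (hz : IsMeanPoint m T x z) (hz' : IsMeanPoint m' T x z') (hR0 : 0 ≤ R)
    (hR : ∀ s, ‖(T s x : H)‖ ≤ R) : ‖z - z'‖ ≤ ‖m - m'‖ * R := by
  obtain ⟨g, hg, h⟩ := hz (innerSL ℂ (z - z'))
  have h' := hz'.apply_eq _ g hg
  have hgn : ‖g‖ ≤ ‖z - z'‖ * R := norm_le_of_forall _ (by positivity) fun t => by
    rw [hg]
    exact (norm_inner_le_norm _ _).trans (by gcongr; exact hR t)
  have h1 : ‖z - z'‖ ^ 2 ≤ ‖m - m'‖ * (‖z - z'‖ * R) := by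
    calc ‖z - z'‖ ^ 2 = ‖innerSL ℂ (z - z') (z - z')‖ := by
          rw [innerSL_apply_apply, inner_self_eq_norm_sq_to_K]; simp
      _ = ‖(m - m') g‖ := by rw [map_sub, h, h']; rfl
      _ ≤ _ := ((m - m').le_opNorm g).trans (by gcongr)
  rcases (norm_nonneg (z - z')).eq_or_lt with h0 | h0
  · rw [← h0]; positivity
  · refine le_of_mul_le_mul_right ?_ h0
    calc _ = ‖z - z'‖ ^ 2 := by ring
      _ ≤ _ := h1
      _ = _ := by ring

/-- Real affine functions along the orbit of `x` are real parts of functions in `X`. -/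
theorem IsMeanPoint.exists_affine {m : StrongDual ℂ X.carrier} (hm : IsMean m) {z : H}
    (hz : IsMeanPoint m T x z) (v : H) (b : ℝ) :
    ∃ g : X.carrier, (∀ s, ((g : S →ᵇ ℂ) s).re = (inner ℂ v (T s x : H)).re + b) ∧
      (m g).re = (inner ℂ v z).re + b := by
  obtain ⟨g, hg, h⟩ := hz (innerSL ℂ v)
  refine ⟨g + (b : ℂ) • ⟨1, X.one_mem⟩, fun s => ?_, ?_⟩
  · simp [hg]
  · rw [map_add, map_smul, hm.2, ← h]
    simp

theorem IsMeanPoint.mem_attractivePoints (hT : IsRepresentation T) (hTne : IsNonexpansive T)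
    (hR : ∀ s, ‖(T s x : H)‖ ≤ R) {m : StrongDual ℂ X.carrier} (hm : IsMean m)
    (hml : IsLeftInvariant m) {z : H} (hz : IsMeanPoint m T x z) : z ∈ attractivePoints T := by
  intro s y
  have expand : ∀ p : H, ‖p - y‖ ^ 2 - ‖p - T s y‖ ^ 2 =
      (inner ℂ ((2 : ℂ) • ((T s y : H) - y)) p).re + (‖(y : H)‖ ^ 2 - ‖(T s y : H)‖ ^ 2) := by
    intro p
    rw [norm_sub_sq_eq, norm_sub_sq_eq, inner_smul_left, inner_sub_left]
    simp
    ring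
  obtain ⟨a, ha, hma⟩ := hz.exists_affine hm ((2 : ℂ) • ((T s y : H) - y))
    (‖(y : H)‖ ^ 2 - ‖(T s y : H)‖ ^ 2)
  rw [← expand] at hma
  let B : Set ℝ := {r | ∃ g : X.carrier,
    (∀ t, ((g : S →ᵇ ℂ) t).re ≤ ‖(T t x : H) - T s y‖ ^ 2) ∧ (m g).re = r}
  have hBne : B.Nonempty := ⟨_, 0, fun t => by simp, rfl⟩
  have hBbdd : BddAbove B := by
    refine ⟨(R + ‖(T s y : H)‖) ^ 2, ?_⟩
    rintro _ ⟨g, hg, rfl⟩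
    refine hm.re_le g fun t => (hg t).trans ?_
    gcongr
    exact (norm_sub_le _ _).trans (by gcongr; exact hR t)
  have hshift : ∀ r ∈ B, r ≤ sSup B + (m a).re := by
    rintro _ ⟨g, hg, rfl⟩
    rw [← sub_le_iff_le_add]
    refine le_csSup hBbdd
      ⟨⟨leftTranslate s g, X.left_mem s g g.2⟩ - a, fun t => ?_, by rw [map_sub, hml]; simp⟩
    have h1 : ((g : S →ᵇ ℂ) (s * t)).re ≤ ‖(T t x : H) - y‖ ^ 2 := by
      refine (hg _).trans ?_
      rw [hT]
      gcongr
      exact hTne s _ _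
    have h2 := ha t
    rw [← expand] at h2
    simp only [Submodule.coe_sub, BoundedContinuousFunction.coe_sub, Pi.sub_apply,
      leftTranslate_apply, Complex.sub_re]
    linarith
  have h0 : 0 ≤ (m a).re := by
    have := csSup_le hBne hshift
    linarith
  refine le_of_sq_le_sq ?_ (norm_nonneg _)
  linarith

end Means

/-! ### Attractive points -/

section Attractive

variable {S H : Type*} [NormedAddCommGroup H] {C : Set H}

theorem isClosed_attractivePoints (T : S → C → C) : IsClosed (attractivePoints T) := by
  simp only [attractivePoints, ofPred_forall]
  exact isClosed_iInter fun s => isClosed_iInter fun x =>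
    isClosed_le (by fun_prop) (by fun_prop)

variable [InnerProductSpace ℂ H]

theorem convex_attractivePoints (T : S → C → C) : Convex ℝ (attractivePoints T) := by
  have h : attractivePoints T = ⋂ (s : S) (x : C),
      {a : H | (inner ℂ ((x : H) - T s x) a).re ≤ (‖(x : H)‖ ^ 2 - ‖(T s x : H)‖ ^ 2) / 2} := by
    ext a
    simp only [attractivePoints, mem_ofPred_eq, mem_iInter]
    refine forall₂_congr fun s x => ?_
    rw [← sq_le_sq₀ (norm_nonneg _) (norm_nonneg _), norm_sub_sq_eq, norm_sub_sq_eq,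
      inner_sub_left, Complex.sub_re]
    constructor <;> intro h <;> linarith
  rw [h]
  refine convex_iInter fun s => convex_iInter fun x =>
    convex_halfSpace_le ⟨fun a b => ?_, fun r a => ?_⟩ _
  · rw [inner_add_right, Complex.add_re]
  · rw [← Complex.coe_smul, inner_smul_right, Complex.re_ofReal_mul, smul_eq_mul]

theorem IsNearestPoint.re_inner_nonpos {D : Set H} (hD : Convex ℝ D) {y p : H}
    (hp : IsNearestPoint D y p) {a : H} (ha : a ∈ D) : (inner ℂ (y - p) (a - p)).re ≤ 0 := by
  let _ : InnerProductSpace ℝ H := InnerProductSpace.complexToReal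
  have : Nonempty D := ⟨⟨a, ha⟩⟩
  refine (norm_eq_iInf_iff_real_inner_le_zero hD hp.1).1 ?_ a ha
  refine le_antisymm (le_ciInf fun w => ?_)
    (ciInf_le (f := fun w : D => ‖y - w‖) ⟨0, by rintro _ ⟨w, rfl⟩; exact norm_nonneg _⟩ ⟨p, hp.1⟩)
  rw [norm_sub_rev y p, norm_sub_rev y w]
  exact hp.2 w w.2

theorem IsNearestPoint.norm_sub_sq_le {D : Set H} (hD : Convex ℝ D) {y p : H}
    (hp : IsNearestPoint D y p) {a : H} (ha : a ∈ D) :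
    ‖a - p‖ ^ 2 ≤ ‖a - y‖ ^ 2 - ‖p - y‖ ^ 2 := by
  have h := hp.re_inner_nonpos hD ha
  have e : a - y = (a - p) - (y - p) := by abel
  rw [e, norm_sub_sq_eq (a - p), norm_sub_rev p y]
  linarith

end Attractive

/-! ### The order on the semigroup -/

section Order

variable {S : Type*} [Semigroup S] [TopologicalSpace S]

theorem IdealLE.refl (a : S) : IdealLE a a := subset_rfl

theorem IdealLE.trans {a b c : S} (hab : IdealLE a b) (hbc : IdealLE b c) : IdealLE a c :=
  Subset.trans hbc hab

theorem IdealLE.le_of_continuous {a b : S} (h : IdealLE a b) {G : S → ℝ} (hG : Continuous G)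
    (hle : ∀ t, G (t * a) ≤ G a) : G b ≤ G a := by
  rcases h (Or.inr rfl) with hb | rfl
  · refine closure_minimal (t := {b | G b ≤ G a}) ?_ (isClosed_le hG continuous_const) hb
    rintro _ ⟨t, rfl⟩
    exact hle t
  · exact le_rfl

theorem norm_sub_le_of_idealLE {E : Type*} [NormedAddCommGroup E] {C : Set E} {T : S → C → C}
    (hT : IsRepresentation T)
    (hTcont : IsSeparatelyContinuous T) {a : E} (ha : a ∈ attractivePoints T) (x : C)
    {s t : S} (h : IdealLE s t) :
    ‖a - T t x‖ ≤ ‖a - T s x‖ := by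
  refine h.le_of_continuous (G := fun t => ‖a - T t x‖)
    (continuous_const.sub (continuous_subtype_val.comp (hTcont.1 x))).norm fun r => ?_
  rw [hT]
  exact ha r (T s x)

variable [SeparatelyContinuousMul S]

theorem idealLE_of_mem_closure {a b : S} (h : b ∈ closure (range fun s => s * a)) :
    IdealLE a b := by
  refine subset_union_of_subset_left (union_subset (closure_minimal ?_ isClosed_closure)
    (singleton_subset_iff.2 h)) _
  rintro _ ⟨s, rfl⟩
  refine map_mem_closure (continuous_const_mul s) h ?_
  rintro _ ⟨t, rfl⟩
  exact ⟨s * t, mul_assoc s t a⟩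

theorem idealLE_mul (t a : S) : IdealLE a (t * a) :=
  idealLE_of_mem_closure (subset_closure ⟨t, rfl⟩)

theorem RightReversible.exists_idealLE (hS : RightReversible S) (a b : S) :
    ∃ c, IdealLE a c ∧ IdealLE b c := by
  obtain ⟨c, hca, hcb⟩ := hS a b
  exact ⟨c, idealLE_of_mem_closure hca, idealLE_of_mem_closure hcb⟩

variable (S) in
/-- The filter of the increasing limits in the preorder `IdealLE`. -/
def idealFilter : Filter S := ⨅ a : S, 𝓟 {b | IdealLE a b}

theorem RightReversible.hasBasis_idealFilter [Nonempty S] (hS : RightReversible S) :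
    (idealFilter S).HasBasis (fun _ : S => True) fun a => {b | IdealLE a b} := by
  refine hasBasis_iInf_principal fun a b => ?_
  obtain ⟨c, hac, hbc⟩ := hS.exists_idealLE a b
  exact ⟨c, fun d hd => hac.trans hd, fun d hd => hbc.trans hd⟩

variable {H : Type*} [NormedAddCommGroup H] [InnerProductSpace ℂ H] [CompleteSpace H] {C : Set H}
variable {T : S → C → C}

theorem exists_idealTendsto_metricProj [Nonempty S] (hS : RightReversible S)
    (hT : IsRepresentation T) (hTcont : IsSeparatelyContinuous T)
    (hne : (attractivePoints T).Nonempty) (x : C) :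
    ∃ u ∈ attractivePoints T,
      IdealTendsto (fun t => metricProj (attractivePoints T) (T t x : H)) u := by
  set A := attractivePoints T
  let P : S → H := fun t => metricProj A (T t x : H)
  have hP : ∀ t, IsNearestPoint A (T t x : H) (P t) := fun t =>
    metricProj_isNearestPoint hne (isClosed_attractivePoints T) (convex_attractivePoints T) _
  let d : S → ℝ := fun t => ‖P t - T t x‖ ^ 2
  have hPd : ∀ s t, IdealLE s t → ‖P s - P t‖ ^ 2 ≤ d s - d t := fun s t hst => by
    refine ((hP t).norm_sub_sq_le (convex_attractivePoints T) (hP s).1).trans ?_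
    have := norm_sub_le_of_idealLE hT hTcont (hP s).1 x hst
    change _ ≤ ‖P s - T s x‖ ^ 2 - ‖P t - T t x‖ ^ 2
    gcongr
  have hbdd : BddBelow (range d) := ⟨0, by rintro _ ⟨t, rfl⟩; positivity⟩
  have hB := hS.hasBasis_idealFilter
  have : NeBot (idealFilter S) := hB.neBot_iff.2 fun {a} _ => ⟨a, IdealLE.refl a⟩
  have hcau : Cauchy (map P (idealFilter S)) := by
    refine Metric.cauchy_iff.2 ⟨inferInstance, fun ε hε => ?_⟩
    obtain ⟨_, ⟨s, rfl⟩, hs⟩ := exists_lt_of_csInf_lt (range_nonempty d)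
      (lt_add_of_pos_right (sInf (range d)) (by positivity : 0 < (ε / 2) ^ 2))
    have hclose : ∀ t, IdealLE s t → dist (P s) (P t) < ε / 2 := fun t hst => by
      rw [dist_eq_norm]
      refine lt_of_pow_lt_pow_left₀ 2 (by positivity) ((hPd s t hst).trans_lt ?_)
      have := csInf_le hbdd ⟨t, rfl⟩
      linarith
    refine ⟨P '' {t | IdealLE s t}, image_mem_map (hB.mem_of_mem trivial), ?_⟩
    rintro _ ⟨t, ht, rfl⟩ _ ⟨t', ht', rfl⟩
    have := dist_triangle_left (P t) (P t') (P s)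
    linarith [hclose t ht, hclose t' ht']
  obtain ⟨u, hu⟩ := CompleteSpace.complete hcau
  refine ⟨u, ?_, fun U hU => ?_⟩
  · exact (isClosed_attractivePoints T).mem_of_tendsto hu (Eventually.of_forall fun t => (hP t).1)
  · obtain ⟨a, -, ha⟩ := hB.mem_iff.1 (hu hU)
    exact ⟨a, fun b hb => ha hb⟩

theorem IsMeanPoint.eq_of_idealTendsto {X : InvSubspace S} {x : C} {R : ℝ} (hR0 : 0 ≤ R)
    (hR : ∀ s, ‖(T s x : H)‖ ≤ R) {m : StrongDual ℂ X.carrier} (hm : IsMean m)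
    (hmr : IsRightInvariant m) {z : H} (hz : IsMeanPoint m T x z) (hzA : z ∈ attractivePoints T)
    {u : H} (huA : u ∈ attractivePoints T)
    (hu : IdealTendsto (fun t => metricProj (attractivePoints T) (T t x : H)) u) : z = u := by
  set A := attractivePoints T
  let P : S → H := fun t => metricProj A (T t x : H)
  have hP : ∀ t, IsNearestPoint A (T t x : H) (P t) := fun t =>
    metricProj_isNearestPoint ⟨u, huA⟩ (isClosed_attractivePoints T) (convex_attractivePoints T) _
  set M : ℝ := ‖u‖ + R + ‖z - u‖ with hM
  have hM0 : 0 ≤ M := by positivity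
  have key : ∀ ε : ℝ, 0 < ε → ‖z - u‖ ^ 2 ≤ M * ε := by
    intro ε hε
    obtain ⟨a, ha⟩ := hu _ (Metric.ball_mem_nhds u hε)
    have hbound : ∀ b, IdealLE a b → (inner ℂ (z - u) ((T b x : H) - u)).re ≤ M * ε := by
      intro b hb
      have hPu : ‖P b - u‖ ≤ ε := (mem_ball_iff_norm.1 (ha b hb)).le
      have hd : ‖(T b x : H) - P b‖ ≤ ‖u‖ + R := by
        rw [norm_sub_rev]
        exact ((hP b).2 u huA).trans ((norm_sub_le _ _).trans (by gcongr; exact hR b))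
      have e : inner ℂ ((T b x : H) - u) (z - u) = inner ℂ ((T b x : H) - P b) (z - P b) +
          inner ℂ ((T b x : H) - P b) (P b - u) + inner ℂ (P b - u) (z - u) := by
        simp only [inner_sub_left, inner_sub_right]
        ring
      have h1 := (hP b).re_inner_nonpos (convex_attractivePoints T) hzA
      have h2 : (inner ℂ ((T b x : H) - P b) (P b - u)).re ≤ (‖u‖ + R) * ε :=
        (re_inner_le_norm (𝕜 := ℂ) _ _).trans (by gcongr)
      have h3 : (inner ℂ (P b - u) (z - u)).re ≤ ε * ‖z - u‖ :=
        (re_inner_le_norm (𝕜 := ℂ) _ _).trans (by gcongr)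
      rw [← inner_conj_symm, Complex.conj_re, e, Complex.add_re, Complex.add_re, hM]
      linarith
    obtain ⟨g, hg, hmg⟩ := hz.exists_affine hm (z - u) (-(inner ℂ (z - u) u).re)
    have e : ∀ p : H, (inner ℂ (z - u) p).re + -(inner ℂ (z - u) u).re =
        (inner ℂ (z - u) (p - u)).re := fun p => by
      rw [inner_sub_right _ p, Complex.sub_re]
      exact (sub_eq_add_neg _ _).symm
    have h := hm.re_le (M := M * ε) ⟨rightTranslate a g, X.right_mem a g g.2⟩ fun t => by
      rw [rightTranslate_apply, hg, e]
      exact hbound _ (idealLE_mul t a)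
    rw [hmr, hmg, e, inner_self_eq_norm_sq_to_K] at h
    have e' : (((‖z - u‖ : ℝ) : ℂ) ^ 2).re = ‖z - u‖ ^ 2 := by
      rw [← Complex.ofReal_pow, Complex.ofReal_re]
    exact e'.symm.le.trans h
  have h0 : ‖z - u‖ ^ 2 ≤ 0 := by
    refine le_of_forall_pos_le_add fun δ hδ => ?_
    rw [zero_add]
    refine (key (δ / (M + 1)) (by positivity)).trans ?_
    rw [mul_div_assoc', div_le_iff₀ (by positivity), mul_comm]
    gcongr
    linarith
  rw [← sub_eq_zero, ← norm_eq_zero]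
  exact pow_eq_zero_iff two_ne_zero |>.1 (le_antisymm h0 (by positivity))

end Order

end Ergodic

end

open Ergodic

theorem mainTheorem11
    {S : Type*} [Semigroup S] [TopologicalSpace S] [T2Space S] [SeparatelyContinuousMul S]
    {H : Type*} [NormedAddCommGroup H] [InnerProductSpace ℂ H] [CompleteSpace H]
    (hS : Ergodic.RightReversible S)
    (C : Set H) (hC : IsClosed C)
    (T : S → C → C) (hT : Ergodic.IsRepresentation T)
    (hTcont : Ergodic.IsSeparatelyContinuous T) (hTne : Ergodic.IsNonexpansive T)
    (c : C) (hc : Bornology.IsBounded (Set.range fun s => (T s c : H)))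
    (X : Ergodic.InvSubspace S)
    (hX :
      (X = Ergodic.CbSpace S ∧ Continuous fun s => Ergodic.toWeakSubset (T s c)) ∨
      (Ergodic.HasOrbitClosuresIn T ∧
        ((X = Ergodic.LUCSpace S ∧ Ergodic.IsWeaklyJointlyContinuous T) ∨
         (X = Ergodic.APSpace S ∧ Ergodic.IsWeaklyEquicontinuous T) ∨
         (X = Ergodic.WAPSpace S ∧ Ergodic.IsWeaklyQuasiEquicontinuous T) ∨
         (X = Ergodic.APSpace S ∧ Ergodic.LeftReversible S ∧
            TopologicalSpace.SeparableSpace S ∧ Ergodic.IsWeaklyEquicontinuous T))))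
    {ι : Type*} [Preorder ι] [IsDirectedOrder ι] [Nonempty ι]
    (μ : ι → StrongDual ℂ X.carrier) (hμ : ∀ α, Ergodic.IsMean (μ α))
    (hμl : Ergodic.AsympLeftInvariant μ) (hμr : Ergodic.AsympRightInvariant μ) :
    ((Ergodic.attractivePoints T).Nonempty ∧ IsClosed (Ergodic.attractivePoints T) ∧
      Convex ℝ (Ergodic.attractivePoints T)) ∧
    ∀ x : C,
      (∀ m : StrongDual ℂ X.carrier, Ergodic.IsMean m →
        Ergodic.IsMeanPoint m T x (Ergodic.meanPoint m T x)) ∧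
      ∃ u ∈ Ergodic.attractivePoints T,
        Ergodic.IdealTendsto
          (fun t => Ergodic.metricProj (Ergodic.attractivePoints T) (T t x : H)) u ∧
        Tendsto (fun α => toWeakSpace ℂ H (Ergodic.meanPoint (μ α) T x)) atTop
          (𝓝 (toWeakSpace ℂ H u)) ∧
        ∀ m : StrongDual ℂ X.carrier, Tendsto μ atTop (𝓝 m) →
          Tendsto (fun α => Ergodic.meanPoint (μ α) T x) atTop (𝓝 u) := by
  obtain ⟨α₀⟩ := ‹Nonempty ι›
  have hSne : Nonempty S := (hμ α₀).nonempty
  have hbd := exists_orbit_bound hTne hc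
  have hco : ∀ (x : C) (f : StrongDual ℂ H),
      ∃ g : X.carrier, ∀ s, (g : BoundedContinuousFunction S ℂ) s = f (T s x : H) := by
    intro x f
    obtain ⟨R, -, hR⟩ := hbd x
    obtain ⟨g, hg⟩ := exists_coefficient hTcont hR f
    suffices h : g ∈ X.carrier from ⟨⟨g, h⟩, hg⟩
    rcases hX with ⟨rfl, -⟩ | ⟨hcl, ⟨rfl, hj⟩ | ⟨rfl, he⟩ | ⟨rfl, hq⟩ | ⟨rfl, -, -, he⟩⟩
    · trivial
    · exact coefficient_mem_LUC hT hTcont hcl hj hR hg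
    · exact coefficient_mem_AP hT hTcont hcl he hR hg
    · exact coefficient_mem_WAP hT hTcont (fun y => (hbd y).imp fun _ h => h.2) hcl hq hg
    · exact coefficient_mem_AP hT hTcont hcl he hR hg
  have hmp : ∀ (m : StrongDual ℂ X.carrier) (x : C), IsMeanPoint m T x (meanPoint m T x) := by
    intro m x
    obtain ⟨R, hR0, hR⟩ := hbd x
    exact isMeanPoint_meanPoint m (hco x) hR0 hR
  have hatt : ∀ (m : StrongDual ℂ X.carrier) (x : C), IsMean m → IsLeftInvariant m →
      meanPoint m T x ∈ attractivePoints T := by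
    intro m x hm hml
    obtain ⟨R, -, hR⟩ := hbd x
    exact (hmp m x).mem_attractivePoints hT hTne hR hm hml
  have hne : (attractivePoints T).Nonempty := by
    obtain ⟨m, hm, hml, -, -⟩ := exists_invariant_mean_of_ultrafilter hμ hμl hμr
      (Ultrafilter.of_le Filter.atTop)
    exact ⟨_, hatt m c hm hml⟩
  refine ⟨⟨hne, isClosed_attractivePoints T, convex_attractivePoints T⟩,
    fun x => ⟨fun m _ => hmp m x, ?_⟩⟩
  obtain ⟨R, hR0, hR⟩ := hbd x
  obtain ⟨u, huA, hu⟩ := exists_idealTendsto_metricProj hS hT hTcont hne x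
  have hweak : Tendsto (fun α => toWeakSpace ℂ H (meanPoint (μ α) T x)) atTop
      (𝓝 (toWeakSpace ℂ H u)) := by
    rw [tendsto_iff_ultrafilter]
    intro w hw
    obtain ⟨m, hm, hml, hmr, hlim⟩ := exists_invariant_mean_of_ultrafilter hμ hμl hμr hw
    rw [← (hmp m x).eq_of_idealTendsto hR0 hR hm hmr (hatt m x hm hml) huA hu]
    refine tendsto_toWeakSpace_iff.2 fun f => ?_
    obtain ⟨g, hg⟩ := hco x f
    simp only [fun α => (hmp (μ α) x).apply_eq f g hg, (hmp m x).apply_eq f g hg]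
    exact hlim g
  refine ⟨u, huA, hu, hweak, fun m hm => ?_⟩
  have hnorm : Tendsto (fun α => meanPoint (μ α) T x) atTop (𝓝 (meanPoint m T x)) := by
    have hm' : Tendsto (fun α => ‖μ α - m‖) atTop (𝓝 0) :=
      tendsto_norm_sub_of_tendsto_strongDual hm
    rw [tendsto_iff_norm_sub_tendsto_zero]
    refine squeeze_zero (fun _ => norm_nonneg _)
      (fun α => norm_sub_le_of_isMeanPoint (hmp (μ α) x) (hmp m x) hR0 hR) ?_
    simpa using hm'.mul_const R
  have huniq : meanPoint m T x = u := (toWeakSpace ℂ H).injective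
    (tendsto_nhds_unique (tendsto_toWeakSpace_iff.2 fun f => (f.continuous.tendsto _).comp hnorm)
      hweak)
  rwa [huniq] at hnorm
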